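/- **Setting.** Let $k>d\ge 1$ and $t\ge 1$ be integers and let $p_1,\dots,p_k,q_1,\dots,q_k\ge 0$ be integers such that $n_i:=tp_i+q_i\ge 1$ for every $i$. Let $H=K_k-S_d$ be the graph obtained from the complete graph on $\{v_1,\dots,v_k\}$ by deleting the edges of the star on the $d$ vertices $v_1,\dots,v_d$ with centre $v_1$, i.e. the edges $v_1v_2,\dots,v_1v_d$. Let $G=H_{p_1,\dots,p_k}^{q_1,\dots,q_k}$ be the generalized blow-up of $H$: each $v_i$ is replaced by the graph $G_i=p_iK_t\cup q_iK_1$ (disjoint copies), and every vertex of $G_i$ is joined to every vertex of $G_j$ whenever $v_iv_j\in E(H)$. Write $V_i^{p_i}$ and $V_i^{q_i}$ for the sets of vertices of $G_i$ in the copies of $K_t$ and of $K_1$ respectively, $n=|V(G)|=\sum_{i=1}^k n_i$ and $m=n-\sum_{s=1}^d n_s$. The resistance distance $R_G(u,v)$ is the potential difference between $u$ and $v$ when every edge of $G$ is a unit resistor and a unit current enters at $u$ and leaves at $v$. Put $$D_1=m,\qquad D_i=n-n_1-n_i\ (2\le i\le d),\qquad D_i=n-n_i\ (d+1\le i\le k).$$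 **Claim.** $G$ is connected, and its resistance distances are as follows (all remaining cases follow from $R_G(u,v)=R_G(v,u)$). (i) For $1\le i\le k$ and distinct $u,v\in V_i^{p_i}\cup V_i^{q_i}$, $$R_G(u,v)=\begin{cases}\dfrac{2}{D_i}, & u,v\in V_i^{q_i};\\[2mm] \dfrac{2D_i+t+1}{D_i(D_i+t)}, & u\in V_i^{p_i},\ v\in V_i^{q_i};\\[2mm] \dfrac{2}{D_i+t}, & u,v\in V_i^{p_i},\ uv\in E(G);\\[2mm] \dfrac{2(D_i+1)}{D_i(D_i+t)}, & u,v\in V_i^{p_i},\ uv\notin E(G).\end{cases}$$ (ii) For $i\ne j$, $u\in V_i^{p_i}\cup V_i^{q_i}$ and $v\in V_j^{p_j}\cup V_j^{q_j}$, $$R_G(u,v)=R'+c(u)+c(v),$$ where, for a vertex $w\in V_i^{p_i}\cup V_i^{q_i}$, $$c(w)=\frac{n_i-1}{n_iD_i}\ \text{ if } w\in V_i^{q_i},\qquad c(w)=\frac{(n_i-1)(D_i+1)+1-t}{n_iD_i(D_i+t)}\ \text{ if } w\in V_i^{p_i},$$ and $R'$ depends on $i,j$ as follows: (a) $i=1$,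 $2\le j\le d$: $R'=R_1'=\dfrac{n\,n_j+n_1m}{n_1n_j(n-n_1)m}$; (b) $i=1$, $d+1\le j\le k$: $R'=R_2'=\dfrac{n-n_1}{n\,n_1m}+\dfrac1{n\,n_j}$; (c) $2\le i\ne j\le d$: $R'=R_3'=\dfrac{n_i+n_j}{(n-n_1)n_in_j}$; (d) $2\le i\le d$, $d+1\le j\le k$: $R'=R_4'=\dfrac{n_1n_i+n\,m}{n\,n_i(n-n_1)m}+\dfrac1{n\,n_j}$; (e) $d+1\le i\ne j\le k$: $R'=R_5'=\dfrac1{n\,n_i}+\dfrac1{n\,n_j}$. -/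

import Mathlib

open Classical in
/-- `f` is a potential (voltage) for a unit current entering at `u` and leaving at `v`, every edge
of `G` being a unit resistor: Kirchhoff's law `L f = e_u - e_v`, `L` the Laplacian matrix. -/
def IsUnitPotential {V : Type*} [Fintype V] (G : SimpleGraph V) (u v : V) (f : V → ℝ) : Prop :=
  (G.lapMatrix ℝ).mulVec f = Pi.single u 1 - Pi.single v 1

open Classical in
/-- The resistance distance: the potential difference between `u` and `v` for a unit current
from `u` to `v` (with value `0` if no such current exists, which happens exactly when `u` and `v`
lie in different components). By `resistanceDist_eq` it does not depend on the potential. -/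
noncomputable def resistanceDist {V : Type*} [Fintype V] (G : SimpleGraph V) (u v : V) : ℝ :=
  if h : ∃ f, IsUnitPotential G u v f then h.choose u - h.choose v else 0

theorem resistanceDist_eq {V : Type*} [Fintype V] (G : SimpleGraph V) (u v : V) (f : V → ℝ)
    (hf : IsUnitPotential G u v f) : resistanceDist G u v = f u - f v := by
  classical
  have hex : ∃ f, IsUnitPotential G u v f := ⟨f, hf⟩
  have hg := hex.choose_spec
  have hR : resistanceDist G u v = hex.choose u - hex.choose v := dif_pos hex
  rw [hR]
  generalize hex.choose = g at hg
  unfold IsUnitPotential at hf hg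
  have h1 : g ⬝ᵥ (G.lapMatrix ℝ).mulVec f = f ⬝ᵥ (G.lapMatrix ℝ).mulVec g := by
    rw [Matrix.dotProduct_mulVec, dotProduct_comm, ← Matrix.mulVec_transpose,
      (SimpleGraph.isSymm_lapMatrix (R := ℝ) (G := G)).eq]
  have e1 : (G.lapMatrix ℝ).mulVec f = Pi.single u 1 - Pi.single v 1 := by convert hf
  have e2 : (G.lapMatrix ℝ).mulVec g = Pi.single u 1 - Pi.single v 1 := by convert hg
  rw [e1, e2] at h1
  simpa [dotProduct_sub] using h1

/-- The generalized join `H[G_1, …, G_k]`: every vertex `i` of `H` is replaced by the graph `G i`,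
and all vertices of `G i` are joined to all vertices of `G j` whenever `i j` is an edge of `H`. -/
def generalizedJoin {ι : Type*} {V : ι → Type*} (H : SimpleGraph ι)
    (G : ∀ i, SimpleGraph (V i)) : SimpleGraph (Σ i, V i) where
  Adj x y := H.Adj x.1 y.1 ∨ ∃ (i : ι) (a b : V i), x = ⟨i, a⟩ ∧ y = ⟨i, b⟩ ∧ (G i).Adj a b
  symm := by
    constructor
    rintro x y (h | ⟨i, a, b, hx, hy, h⟩)
    · exact Or.inl h.symm
    · exact Or.inr ⟨i, b, a, hy, hx, h.symm⟩
  loopless := by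
    constructor
    rintro x (h | ⟨i, a, b, hx, hy, h⟩)
    · exact H.loopless.irrefl _ h
    · have hab : a = b := by
        rw [hx] at hy
        simpa using hy
      exact h.ne hab

/-- Vertices of `p K_t ∪ q K_1`: `inl (a, c)` is the `c`-th vertex of the `a`-th copy of `K_t`,
and `inr b` is the `b`-th isolated vertex. -/
abbrev PartVertex (t p q : ℕ) : Type := (Fin p × Fin t) ⊕ Fin q

/-- The disjoint union `p K_t ∪ q K_1`. -/
def partGraph (t p q : ℕ) : SimpleGraph (PartVertex t p q) :=
  SimpleGraph.fromRel fun x y => ∃ (a : Fin p) (c c' : Fin t), x = Sum.inl (a, c) ∧ y = Sum.inl (a, c')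

/-- Vertices of the generalized blow-up. -/
abbrev BlowUpVertex {k : ℕ} (t : ℕ) (p q : Fin k → ℕ) : Type :=
  Σ i : Fin k, PartVertex t (p i) (q i)

/-- The generalized blow-up of `H`: the vertex `i` is replaced by `p i` copies of `K_t` and
`q i` isolated vertices. -/
def generalizedBlowUp {k : ℕ} (H : SimpleGraph (Fin k)) (t : ℕ) (p q : Fin k → ℕ) :
    SimpleGraph (BlowUpVertex t p q) :=
  generalizedJoin H fun i => partGraph t (p i) (q i)

/-- The vertices of the blow-up in the copies of `K_t` of the `i`-th part. -/
def Vp {k : ℕ} (t : ℕ) (p q : Fin k → ℕ) (i : Fin k) : Set (BlowUpVertex t p q) :=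
  Set.range fun a : Fin (p i) × Fin t => ⟨i, Sum.inl a⟩

/-- The vertices of the blow-up in the copies of `K_1` of the `i`-th part. -/
def Vq {k : ℕ} (t : ℕ) (p q : Fin k → ℕ) (i : Fin k) : Set (BlowUpVertex t p q) :=
  Set.range fun b : Fin (q i) => ⟨i, Sum.inr b⟩

/-- The edges of a star on the `d` vertices `0, …, d - 1` with centre `0`, as a graph on `k`
vertices. -/
def starOn (k d : ℕ) : SimpleGraph (Fin k) :=
  SimpleGraph.fromRel fun i j => i.val = 0 ∧ j.val < d

/-- `K_k - S_d`: the complete graph minus the edges of a star on the vertices `0, …, d - 1`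
with centre `0`. -/
def completeMinusStar (k d : ℕ) : SimpleGraph (Fin k) :=
  (⊤ : SimpleGraph (Fin k)).deleteEdges (starOn k d).edgeSet

/-! Suppose `g u` solves `L (g u) = e_u - c·1` for every vertex `u`, with the same constant `c`.
Then `g u - g v` is a unit potential from `u` to `v`, so R(u,v) = g(u,u) + g(v,v) - g(u,v) - g(v,u).
The task is thus to exhibit one such `g` for the blow-up.

All vertices of a part have the same neighbours outside it, so the Laplacian respects the splitting
of functions into those constant on every part and those of zero sum on every part. On the first it
acts as the Laplacian of `H` weighted by the part sizes; on the second it acts within part i as D_i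
+ L_i, where L_i is the Laplacian of p_i K_t ∪ q_i K_1. Correspondingly `g` is a sum K(i,j) + δ_ij
h_i, with K a Green function of weighted `H` (`starGreen_eq`) and h_i one of D_i + L_i
(`partGreen_eq`, `partGreen_sum`); `netFlow_blowUp_green` glues them.

Within a part K cancels and only h_i contributes. Between different parts the off-diagonal entries
involve K alone, so K gives R', and the diagonal entries of h_i and h_j give c(u) and c(v). -/

/-! ### Net flow and Green functions -/

open Classical in
/-- The total current leaving `x` under the potential `f`. -/
noncomputable def netFlow {V : Type*} [Fintype V] (G : SimpleGraph V) (f : V → ℝ) (x : V) : ℝ :=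
  ∑ y, if G.Adj x y then f x - f y else 0

open Classical in
theorem lapMatrix_mulVec_eq_netFlow {V : Type*} [Fintype V] (G : SimpleGraph V) (f : V → ℝ) :
    (G.lapMatrix ℝ).mulVec f = netFlow G f := by
  funext x
  rw [SimpleGraph.lapMatrix_mulVec_apply, netFlow, ← Finset.sum_filter, Finset.sum_sub_distrib,
    Finset.sum_const, ← SimpleGraph.card_neighborFinset_eq_degree, nsmul_eq_mul]
  have h : G.neighborFinset x = Finset.univ.filter (G.Adj x) := by
    ext y
    simp
  rw [h]

open Classical in
/-- The resistance distance in terms of a Green function of the Laplacian. -/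
theorem resistanceDist_eq_of_green {V : Type*} [Fintype V] (G : SimpleGraph V) (g : V → V → ℝ)
    (c : ℝ) (hg : ∀ u x, netFlow G (g u) x = (if x = u then 1 else 0) - c) (u v : V) :
    resistanceDist G u v = g u u + g v v - g u v - g v u := by
  -- The constant `c` cancels in the difference.
  have h : IsUnitPotential G u v (g u - g v) := by
    unfold IsUnitPotential
    rw [Matrix.mulVec_sub, lapMatrix_mulVec_eq_netFlow, lapMatrix_mulVec_eq_netFlow]
    funext x
    simp [hg, Pi.single_apply]
  rw [resistanceDist_eq G u v _ h]
  simp only [Pi.sub_apply]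
  ring

open Classical in
theorem netFlow_generalizedJoin {ι : Type*} [Fintype ι] {V : ι → Type*} [∀ i, Fintype (V i)]
    (H : SimpleGraph ι) (G : ∀ i, SimpleGraph (V i)) (f : (Σ i, V i) → ℝ) (i : ι) (a : V i) :
    netFlow (generalizedJoin H G) f ⟨i, a⟩ =
      netFlow (G i) (fun b => f ⟨i, b⟩) a +
        ∑ j, if H.Adj i j then ∑ b, (f ⟨i, a⟩ - f ⟨j, b⟩) else 0 := by
  have hself : ∀ b, (generalizedJoin H G).Adj ⟨i, a⟩ ⟨i, b⟩ ↔ (G i).Adj a b := by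
    intro b
    constructor
    · rintro (h | ⟨j, x, y, hx, hy, h⟩)
      · exact absurd h (H.loopless.irrefl _)
      · obtain ⟨rfl, hx⟩ := Sigma.mk.inj hx
        obtain rfl := eq_of_heq hx
        obtain rfl := eq_of_heq (Sigma.mk.inj hy).2
        exact h
    · exact fun h => Or.inr ⟨i, a, b, rfl, rfl, h⟩
  have hne : ∀ j b, j ≠ i → ((generalizedJoin H G).Adj ⟨i, a⟩ ⟨j, b⟩ ↔ H.Adj i j) := by
    intro j b hj
    constructor
    · rintro (h | ⟨l, x, y, hx, hy, -⟩)
      · exact h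
      · exact absurd ((Sigma.mk.inj hy).1.trans (Sigma.mk.inj hx).1.symm) hj
    · exact fun h => Or.inl h
  -- At j = i the `H`-term vanishes because `H` has no loops; elsewhere only the `H`-term survives.
  have hsplit : ∀ j, (∑ b, if (generalizedJoin H G).Adj ⟨i, a⟩ ⟨j, b⟩
      then f ⟨i, a⟩ - f ⟨j, b⟩ else 0) =
      (if j = i then netFlow (G i) (fun b => f ⟨i, b⟩) a else 0) +
        if H.Adj i j then ∑ b, (f ⟨i, a⟩ - f ⟨j, b⟩) else 0 := by
    intro j
    by_cases hj : j = i
    · subst hj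
      simp [hself, netFlow]
    · simp only [hne j _ hj, hj, if_false, zero_add]
      split_ifs <;> simp
  rw [netFlow, Fintype.sum_sigma]
  simp only [hsplit, Finset.sum_add_distrib, Finset.sum_ite_eq', Finset.mem_univ, if_true]

/-! ### Laplacian and Green function of a single part -/

theorem partGraph_adj_inl {t p q : ℕ} (a a' : Fin p) (c c' : Fin t) :
    (partGraph t p q).Adj (Sum.inl (a, c)) (Sum.inl (a', c')) ↔ a = a' ∧ c ≠ c' := by
  simp only [partGraph, SimpleGraph.fromRel_adj, ne_eq, Sum.inl.injEq, Prod.mk.injEq]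
  constructor
  · rintro ⟨h, ⟨x, y, z, ⟨rfl, rfl⟩, rfl, rfl⟩ | ⟨x, y, z, ⟨rfl, rfl⟩, rfl, rfl⟩⟩ <;> simp_all
  · rintro ⟨rfl, h⟩
    exact ⟨by simpa using h, Or.inl ⟨a, c, c', by simp⟩⟩

theorem partGraph_not_adj_inl_inr {t p q : ℕ} (x : Fin p × Fin t) (b : Fin q) :
    ¬ (partGraph t p q).Adj (Sum.inl x) (Sum.inr b) := by
  simp [partGraph, SimpleGraph.fromRel_adj]

theorem partGraph_not_adj_inr {t p q : ℕ} (b : Fin q) (y : PartVertex t p q) :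
    ¬ (partGraph t p q).Adj (Sum.inr b) y := by
  simp [partGraph, SimpleGraph.fromRel_adj]

/-- On a copy of K_t the Laplacian is tI - J, with J the all-ones matrix; including the vertex
itself in the sum costs nothing, since its difference is zero. -/
theorem netFlow_partGraph_inl {t p q : ℕ} (f : PartVertex t p q → ℝ) (a : Fin p) (c : Fin t) :
    netFlow (partGraph t p q) f (Sum.inl (a, c)) =
      t * f (Sum.inl (a, c)) - ∑ c', f (Sum.inl (a, c')) := by
  classical
  have h : ∀ a' c', (if (partGraph t p q).Adj (Sum.inl (a, c)) (Sum.inl (a', c'))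
      then f (Sum.inl (a, c)) - f (Sum.inl (a', c')) else 0) =
      if a = a' then f (Sum.inl (a, c)) - f (Sum.inl (a, c')) else 0 := by
    intro a' c'
    rw [partGraph_adj_inl]
    by_cases ha : a = a'
    · subst ha
      by_cases hc : c = c' <;> simp [hc]
    · simp [ha]
  rw [netFlow, Fintype.sum_sum_type, Fintype.sum_prod_type]
  simp only [partGraph_not_adj_inl_inr, if_false, Finset.sum_const_zero, add_zero]
  rw [Finset.sum_congr rfl fun a' _ => Finset.sum_congr rfl fun c' _ => by convert h a' c',
    Finset.sum_comm]
  simp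

theorem netFlow_partGraph_inr {t p q : ℕ} (f : PartVertex t p q → ℝ) (b : Fin q) :
    netFlow (partGraph t p q) f (Sum.inr b) = 0 := by
  simp [netFlow, partGraph_not_adj_inr]

/-- The Green function of `D + L` on functions with zero sum, where `L` is the Laplacian of
`p K_t ∪ q K_1` and `N` the number of its vertices. -/
noncomputable def partGreen {t p q : ℕ} (D N : ℝ) : PartVertex t p q → PartVertex t p q → ℝ
  | Sum.inl x, Sum.inl y =>
    (if y = x then 1 / (D + t) else 0) + (if y.1 = x.1 then 1 / (D * (D + t)) else 0) - 1 / (N * D)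
  | Sum.inr b, Sum.inr b' => (if b' = b then 1 / D else 0) - 1 / (N * D)
  | Sum.inl _, Sum.inr _ => -(1 / (N * D))
  | Sum.inr _, Sum.inl _ => -(1 / (N * D))

/-- The positive entries add up to 1/D: on a clique, 1/(D+t) + t/(D(D+t)) = 1/D. The N entries
-1/(ND) cancel this, which is why N must be the actual size of the part. -/
theorem partGreen_sum {t p q : ℕ} {D N : ℝ} (hD : 0 < D) (hN0 : 0 < N)
    (hN : N = Fintype.card (PartVertex t p q)) (a : PartVertex t p q) :
    ∑ b, partGreen D N a b = 0 := by
  have hDt : 0 < D + t := by positivity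
  have hN' : N = p * t + q := by simpa using hN
  rcases a with x | x
  · rw [Fintype.sum_sum_type, Fintype.sum_prod_type]
    simp only [partGreen, Finset.sum_add_distrib, Finset.sum_sub_distrib, Prod.ext_iff, ite_and]
    simp
    field_simp
    rw [hN']
    ring
  · rw [Fintype.sum_sum_type]
    simp [partGreen]
    field_simp
    rw [hN']
    ring

-- On a clique D + L = (D+t)I - J, and J² = tJ makes its inverse (I + J/D)/(D+t); on isolated
-- vertices the inverse is 1/D. Since L kills constants, the term -1/(ND) accounts for the -1/N on
-- the right.
open Classical in
theorem partGreen_eq {t p q : ℕ} {D N : ℝ} (hD : 0 < D) (hN0 : 0 < N) (a x : PartVertex t p q) :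
    D * partGreen D N a x + netFlow (partGraph t p q) (partGreen D N a) x =
      (if x = a then 1 else 0) - 1 / N := by
  have hDt : 0 < D + t := by positivity
  rcases x with ⟨b, c⟩ | b
  · rw [netFlow_partGraph_inl]
    rcases a with ⟨b', c'⟩ | b'
    · by_cases hb : b = b'
      · subst hb
        by_cases hc : c = c'
        · subst hc
          simp [partGreen, Finset.sum_add_distrib]
          field_simp
          ring
        · simp [partGreen, Finset.sum_add_distrib, hc]
          field_simp
          ring
      · simp [partGreen, hb]
        field_simp
    · simp [partGreen]
      field_simp
  · rw [netFlow_partGraph_inr]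
    rcases a with ⟨b', c'⟩ | b'
    · simp [partGreen]
      field_simp
    · by_cases hb : b = b' <;> simp [partGreen, hb] <;> field_simp

/-! ### Gluing the Green functions of `H` and of the parts -/

open Classical in
/-- A Green function of a generalized blow-up, from one of the weighted graph `H`. -/
theorem netFlow_blowUp_green {k : ℕ} (H : SimpleGraph (Fin k)) (t : ℕ) (p q : Fin k → ℕ)
    (m D : Fin k → ℝ) (hm : ∀ i, m i = Fintype.card (PartVertex t (p i) (q i)))
    (hpos : ∀ i, 0 < m i) (hDpos : ∀ i, 0 < D i)
    (hD : ∀ i, (∑ j, if H.Adj i j then m j else 0) = D i) (K : Fin k → Fin k → ℝ) (c : ℝ)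
    (hK : ∀ l i, D i * K l i - (∑ j, if H.Adj i j then m j * K l j else 0) =
      (if i = l then 1 / m l else 0) - c)
    (g : BlowUpVertex t p q → BlowUpVertex t p q → ℝ)
    (hself : ∀ i a b, g ⟨i, a⟩ ⟨i, b⟩ = K i i + partGreen (D i) (m i) a b)
    (hne : ∀ i j a b, i ≠ j → g ⟨i, a⟩ ⟨j, b⟩ = K i j) (u x : BlowUpVertex t p q) :
    netFlow (generalizedBlowUp H t p q) (g u) x = (if x = u then 1 else 0) - c := by
  obtain ⟨l, a⟩ := u
  obtain ⟨i, b⟩ := x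
  -- The local correction has zero sum, so other parts see only `K`.
  have hsum : ∀ j, ∑ b, g ⟨l, a⟩ ⟨j, b⟩ = m j * K l j := by
    intro j
    by_cases hj : l = j
    · subst hj
      simp only [hself, Finset.sum_add_distrib, partGreen_sum (hDpos l) (hpos l) (hm l)]
      rw [Finset.sum_const, Finset.card_univ, nsmul_eq_mul, ← hm, add_zero]
    · simp only [hne _ _ _ _ hj]
      rw [Finset.sum_const, Finset.card_univ, nsmul_eq_mul, ← hm]
  have hflow : (∑ j, if H.Adj i j then ∑ b', (g ⟨l, a⟩ ⟨i, b⟩ - g ⟨l, a⟩ ⟨j, b'⟩) else 0) =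
      D i * g ⟨l, a⟩ ⟨i, b⟩ - ∑ j, if H.Adj i j then m j * K l j else 0 := by
    rw [← hD, Finset.sum_mul, ← Finset.sum_sub_distrib]
    refine Finset.sum_congr rfl fun j _ => ?_
    split_ifs
    · rw [Finset.sum_sub_distrib, hsum, Finset.sum_const, Finset.card_univ, nsmul_eq_mul, ← hm]
    · simp
  rw [generalizedBlowUp, netFlow_generalizedJoin, hflow]
  have hKi := hK l i
  by_cases hi : l = i
  · subst hi
    have hloc := partGreen_eq (hDpos l) (hpos l) a b
    have hcongr : netFlow (partGraph t (p l) (q l)) (fun b' => g ⟨l, a⟩ ⟨l, b'⟩) b =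
        netFlow (partGraph t (p l) (q l)) (partGreen (D l) (m l) a) b := by
      simp only [netFlow, hself, add_sub_add_left_eq_sub]
    rw [hcongr, hself]
    have hiff : ((⟨l, b⟩ : BlowUpVertex t p q) = ⟨l, a⟩) ↔ b = a := by simp
    simp only [hiff]
    rw [if_pos rfl] at hKi
    -- The source left by the local term is e_a - 1/m_l and the one left by `K` is 1/m_l - c; the
    -- multiples of 1/m_l cancel.
    linarith
  · have hzero : netFlow (partGraph t (p i) (q i)) (fun b' => g ⟨l, a⟩ ⟨i, b'⟩) b = 0 := by
      simp [netFlow, hne _ _ _ _ hi]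
    have hxu : (⟨i, b⟩ : BlowUpVertex t p q) ≠ ⟨l, a⟩ := fun h => hi (Sigma.mk.inj h).1.symm
    rw [hzero, hne _ _ _ _ hi, if_neg hxu]
    rw [if_neg (Ne.symm hi)] at hKi
    linarith

/-! ### The weighted graph `K_k - S_d` -/

theorem completeMinusStar_adj {k d : ℕ} (i j : Fin k) :
    (completeMinusStar k d).Adj i j ↔
      i ≠ j ∧ ¬ (i.val = 0 ∧ j.val < d) ∧ ¬ (j.val = 0 ∧ i.val < d) := by
  simp only [completeMinusStar, starOn, SimpleGraph.deleteEdges_adj, SimpleGraph.top_adj,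
    SimpleGraph.mem_edgeSet, SimpleGraph.fromRel_adj]
  tauto

open Classical in
theorem completeMinusStar_sum_centre {k d : ℕ} [NeZero k] (hd : 1 ≤ d) (w : Fin k → ℝ) :
    (∑ j, if (completeMinusStar k d).Adj 0 j then w j else 0) =
      ∑ j, w j - ∑ j : Fin k with j.val < d, w j := by
  rw [Finset.sum_filter, ← Finset.sum_sub_distrib]
  refine Finset.sum_congr rfl fun j _ => ?_
  rw [completeMinusStar_adj]
  by_cases hj : j.val < d
  · simp [hj]
  · have h0 : j.val ≠ 0 := by omega
    have h0' : (0 : Fin k) ≠ j := fun h => h0 (by rw [← h]; simp)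
    simp [hj, h0', h0]

open Classical in
theorem completeMinusStar_sum_leaf {k d : ℕ} [NeZero k] (w : Fin k → ℝ) (i : Fin k)
    (hi : i ≠ 0) (hid : i.val < d) :
    (∑ j, if (completeMinusStar k d).Adj i j then w j else 0) = ∑ j, w j - w 0 - w i := by
  have h : ∀ j, (if (completeMinusStar k d).Adj i j then w j else 0) =
      w j - (if j = 0 then w j else 0) - (if j = i then w j else 0) := by
    intro j
    have hi' : i.val ≠ 0 := fun h => hi (Fin.ext (by simpa using h))
    rw [completeMinusStar_adj]
    by_cases hj : j = 0
    · subst hj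
      simp [hid, hi.symm]
    · have hj' : j.val ≠ 0 := fun h => hj (Fin.ext (by simpa using h))
      by_cases hji : j = i
      · subst hji
        simp [hj]
      · simp [hj, hj', hi', hji, Ne.symm hji]
  simp [h, Finset.sum_sub_distrib]

open Classical in
theorem completeMinusStar_sum_outside {k d : ℕ} (hd : 1 ≤ d) (w : Fin k → ℝ) (i : Fin k)
    (hid : d ≤ i.val) :
    (∑ j, if (completeMinusStar k d).Adj i j then w j else 0) = ∑ j, w j - w i := by
  have h : ∀ j, (if (completeMinusStar k d).Adj i j then w j else 0) =
      w j - (if j = i then w j else 0) := by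
    intro j
    have hi' : i.val ≠ 0 := by omega
    have hid' : ¬ i.val < d := by omega
    rw [completeMinusStar_adj]
    by_cases hji : j = i
    · subst hji
      simp
    · simp [hi', hid', hji, Ne.symm hji]
  simp [h, Finset.sum_sub_distrib]

/-- The weighted degrees of `K_k - S_d`, for vertex weights `m` of total `n`, of which `S` on the
star. -/
noncomputable def starDegree {k : ℕ} [NeZero k] (d : ℕ) (m : Fin k → ℝ) (n S : ℝ) (i : Fin k) : ℝ :=
  if i = 0 then n - S else if i.val < d then n - m 0 - m i else n - m i

/-- A Green function of the weighted graph `K_k - S_d`. -/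
noncomputable def starGreen {k : ℕ} [NeZero k] (d : ℕ) (m : Fin k → ℝ) (n S : ℝ) (l i : Fin k) :
    ℝ :=
  if l = 0 then
    if i = 0 then (n - m 0) / (n * m 0 * (n - S))
    else if i.val < d then -(1 / (n * (n - S))) else 0
  else if l.val < d then
    if i = 0 then -(1 / (n * (n - S)))
    else if i.val < d then
      (if i = l then 1 / (m l * (n - m 0)) else 0) + m 0 / (n * (n - m 0) * (n - S))
    else 0
  else if i = l then 1 / (n * m l) else 0

open Classical in
theorem starDegree_eq {k d : ℕ} [NeZero k] (hd : 1 ≤ d) (m : Fin k → ℝ) (n S : ℝ)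
    (hn : n = ∑ i, m i) (hS : S = ∑ s : Fin k with s.val < d, m s) (i : Fin k) :
    (∑ j, if (completeMinusStar k d).Adj i j then m j else 0) = starDegree d m n S i := by
  unfold starDegree
  split_ifs with h0 h1
  · rw [h0, completeMinusStar_sum_centre hd, ← hn, ← hS]
  · rw [completeMinusStar_sum_leaf m i h0 h1, ← hn]
  · rw [completeMinusStar_sum_outside hd m i (not_lt.mp h1), ← hn]

/-- The sums of a weighted function that is constant `b` at the centre, `c` on the leaves, `0`
outside the star, up to an additional value `a` at `l`. -/
theorem star_weighted_sum {k d : ℕ} [NeZero k] (hd : 1 ≤ d) (m : Fin k → ℝ) (S : ℝ)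
    (hS : S = ∑ s : Fin k with s.val < d, m s) (l : Fin k) (a b c : ℝ) (φ : Fin k → ℝ)
    (hφ : ∀ j, φ j = (if j = l then a else 0) + (if j = 0 then b - c else 0) +
      if j.val < d then c else 0) :
    ∑ j, m j * φ j = m l * a + m 0 * (b - c) + S * c ∧
    ∑ j : Fin k with j.val < d, m j * φ j =
      (if l.val < d then m l * a else 0) + m 0 * (b - c) + S * c := by
  have hS' : S * c = ∑ j : Fin k, if j.val < d then m j * c else 0 := by
    rw [hS, Finset.sum_mul, Finset.sum_filter]
  constructor
  · simp only [hφ, mul_add, Finset.sum_add_distrib, mul_ite, mul_zero, hS']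
    simp
  · have hφ' : ∀ j, (if j.val < d then m j * φ j else 0) =
        (if j = l then (if l.val < d then m l * a else 0) else 0) +
          (if j = 0 then m 0 * (b - c) else 0) + if j.val < d then m j * c else 0 := by
      intro j
      rw [hφ]
      have h0 : 0 < d := hd
      by_cases hj : j = 0
      · subst hj
        by_cases hl : (0 : Fin k) = l
        · subst hl
          simp [h0]
          ring
        · simp [h0, hl]
          ring
      · by_cases hl : j = l
        · subst hl
          by_cases hjd : j.val < d <;> simp [hj, hjd, mul_add]
        · by_cases hjd : j.val < d <;> simp [hj, hjd, hl]
    rw [Finset.sum_filter, Finset.sum_congr rfl fun j _ => hφ' j, Finset.sum_add_distrib,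
      Finset.sum_add_distrib, hS']
    simp

-- Each row φ of K is normalized by Σ m_j φ_j = 1/n, so that the equation at an index i outside the
-- star reads n φ_i = δ_il / m_l; a source in the star therefore gives 0 there. At the centre it
-- reads (n - S) φ_0 - Σ_{j outside} m_j φ_j = δ_0l / m_l - 1/n, and at a leaf (n - m_0) φ_i + m_0
-- φ_0 = δ_il / m_l. Solving these in turn gives `starGreen`. The verification needs only the sums
-- of the row over all indices and over the star, supplied by `star_weighted_sum`.
open Classical in
theorem starGreen_eq {k d : ℕ} [NeZero k] (hd : 1 ≤ d) (m : Fin k → ℝ)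
    (n S : ℝ) (hS : S = ∑ s : Fin k with s.val < d, m s)
    (hpos : ∀ i, 0 < m i) (hn0 : 0 < n) (hnS : 0 < n - S) (hnm : 0 < n - m 0) (l i : Fin k) :
    starDegree d m n S i * starGreen d m n S l i -
      (∑ j, if (completeMinusStar k d).Adj i j then m j * starGreen d m n S l j else 0) =
      (if i = l then 1 / m l else 0) - 1 / n := by
  have h0d : 0 < d := hd
  have hm0 := hpos 0
  have hml := hpos l
  have hnS' := hnS.ne'
  have hnm' := hnm.ne'
  rcases eq_or_ne l 0 with rfl | hl0
  · obtain ⟨h1, h2⟩ := star_weighted_sum hd m S hS 0 0 ((n - m 0) / (n * m 0 * (n - S)))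
      (-(1 / (n * (n - S)))) (starGreen d m n S 0) (by
        intro j
        by_cases hj : j = 0
        · subst hj
          simp [starGreen, h0d]
        · simp [starGreen, hj])
    rcases eq_or_ne i 0 with rfl | hi0
    · rw [completeMinusStar_sum_centre hd, h1, h2]
      simp [starGreen, starDegree]
      field_simp
    · by_cases hid : i.val < d
      · rw [completeMinusStar_sum_leaf _ i hi0 hid, h1]
        simp [starGreen, starDegree, hi0, hid]
        field_simp
        ring
      · rw [completeMinusStar_sum_outside hd _ i (not_lt.mp hid), h1]
        simp [starGreen, starDegree, hi0, hid]
        field_simp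
        ring
  by_cases hld : l.val < d
  · obtain ⟨h1, h2⟩ := star_weighted_sum hd m S hS l (1 / (m l * (n - m 0))) (-(1 / (n * (n - S))))
      (m 0 / (n * (n - m 0) * (n - S))) (starGreen d m n S l) (by
        intro j
        by_cases hj : j = 0
        · subst hj
          simp [starGreen, h0d, hl0, hl0.symm, hld]
        · by_cases hjl : j = l
          · subst hjl
            simp [starGreen, hj, hld]
          · simp [starGreen, hj, hl0, hld, hjl])
    rcases eq_or_ne i 0 with rfl | hi0
    · rw [completeMinusStar_sum_centre hd, h1, h2]
      simp [starGreen, starDegree, hl0, hl0.symm, hld]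
      field_simp
    · by_cases hid : i.val < d
      · rw [completeMinusStar_sum_leaf _ i hi0 hid, h1]
        by_cases hil : i = l
        · subst hil
          simp [starGreen, starDegree, hi0, hid]
          field_simp
          ring
        · simp [starGreen, starDegree, hi0, hid, hl0, hld, hil]
          field_simp
          ring
      · have hil : i ≠ l := fun h => hid (h ▸ hld)
        rw [completeMinusStar_sum_outside hd _ i (not_lt.mp hid), h1]
        simp [starGreen, starDegree, hi0, hid, hl0, hld, hil]
        field_simp
        ring
  · obtain ⟨h1, h2⟩ := star_weighted_sum hd m S hS l (1 / (n * m l)) 0 0 (starGreen d m n S l) (by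
        intro j
        simp [starGreen, hl0, hld])
    rcases eq_or_ne i 0 with rfl | hi0
    · rw [completeMinusStar_sum_centre hd, h1, h2]
      simp [starGreen, starDegree, hl0, hl0.symm, hld]
      field_simp
    · by_cases hid : i.val < d
      · have hil : i ≠ l := fun h => hld (h ▸ hid)
        rw [completeMinusStar_sum_leaf _ i hi0 hid, h1]
        simp [starGreen, starDegree, hi0, hid, hl0, hl0.symm, hld, hil]
        field_simp
      · rw [completeMinusStar_sum_outside hd _ i (not_lt.mp hid), h1]
        by_cases hil : i = l
        · subst hil
          simp [starGreen, starDegree, hi0, hid]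
          field_simp
        · simp [starGreen, starDegree, hi0, hid, hl0, hld, hil]
          field_simp

/-! ### Connectedness and assembly -/

theorem completeMinusStar_blowUp_connected {k d t : ℕ} [NeZero k] (hd : 1 ≤ d) (hdk : d < k)
    (p q : Fin k → ℕ) (hne : ∀ i, Nonempty (PartVertex t (p i) (q i))) :
    (generalizedBlowUp (completeMinusStar k d) t p q).Connected := by
  obtain ⟨b⟩ := hne ⟨d, hdk⟩
  obtain ⟨a⟩ := hne 0
  have h0 : (⟨d, hdk⟩ : Fin k) ≠ 0 := fun h => by
    have := congrArg Fin.val h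
    simp at this
    omega
  -- With indices starting at 0, the index d is the first one outside the star, so it is joined to
  -- every other index.
  have hadj : ∀ (i : Fin k) x y, i ≠ ⟨d, hdk⟩ →
      (generalizedBlowUp (completeMinusStar k d) t p q).Adj ⟨i, x⟩ ⟨⟨d, hdk⟩, y⟩ := fun i x y hi =>
    Or.inl (completeMinusStar_adj _ _ |>.mpr ⟨hi, by simp, fun h => by simp at h; omega⟩)
  have hreach : ∀ x, (generalizedBlowUp (completeMinusStar k d) t p q).Reachable x
      ⟨⟨d, hdk⟩, b⟩ := by
    rintro ⟨i, x⟩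
    by_cases hi : i = ⟨d, hdk⟩
    · subst hi
      -- Two vertices of part d need not be adjacent, but both are adjacent to any vertex of part 0.
      exact (hadj 0 a x h0.symm).symm.reachable.trans (hadj 0 a b h0.symm).reachable
    · exact (hadj i x b hi).reachable
  exact { preconnected := fun x y => (hreach x).trans (hreach y).symm, nonempty := ⟨⟨_, b⟩⟩ }

/-- The local term compares vertices whose types depend on the part, so its definition needs a
transport along an equality of indices. Keeping only the two evaluation rules hides that transport.
-/
theorem exists_blowUp_green {k : ℕ} {t : ℕ} {p q : Fin k → ℕ} (m D : Fin k → ℝ)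
    (K : Fin k → Fin k → ℝ) :
    ∃ g : BlowUpVertex t p q → BlowUpVertex t p q → ℝ,
      (∀ i a b, g ⟨i, a⟩ ⟨i, b⟩ = K i i + partGreen (D i) (m i) a b) ∧
      ∀ i j a b, i ≠ j → g ⟨i, a⟩ ⟨j, b⟩ = K i j := by
  refine ⟨fun u x => K u.1 x.1 +
    if h : u.1 = x.1 then partGreen (D x.1) (m x.1) (h ▸ u.2) x.2 else 0, ?_, ?_⟩
  · intro i a b
    simp
  · intro i j a b h
    simp [h]

/-- The resistance distances of a generalized blow-up of `K_k - S_d`. -/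
theorem resistanceDist_blowUp {k d t : ℕ} [NeZero k] (hd : 1 ≤ d) (p q : Fin k → ℕ)
    (m : Fin k → ℝ) (hm : ∀ i, m i = Fintype.card (PartVertex t (p i) (q i)))
    (hpos : ∀ i, 0 < m i) (n S : ℝ) (hn : n = ∑ i, m i)
    (hS : S = ∑ s : Fin k with s.val < d, m s) (hn0 : 0 < n) (hnS : 0 < n - S)
    (hnm : 0 < n - m 0) (hDpos : ∀ i, 0 < starDegree d m n S i) :
    (∀ i a b, resistanceDist (generalizedBlowUp (completeMinusStar k d) t p q) ⟨i, a⟩ ⟨i, b⟩ =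
      partGreen (starDegree d m n S i) (m i) a a + partGreen (starDegree d m n S i) (m i) b b -
        partGreen (starDegree d m n S i) (m i) a b -
        partGreen (starDegree d m n S i) (m i) b a) ∧
    ∀ i j a b, i ≠ j →
      resistanceDist (generalizedBlowUp (completeMinusStar k d) t p q) ⟨i, a⟩ ⟨j, b⟩ =
      (starGreen d m n S i i + starGreen d m n S j j - starGreen d m n S i j -
        starGreen d m n S j i) +
      (partGreen (starDegree d m n S i) (m i) a a +
        partGreen (starDegree d m n S j) (m j) b b) := by
  classical
  obtain ⟨g, hself, hne⟩ := exists_blowUp_green (t := t) (p := p) (q := q) m (starDegree d m n S)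
    (starGreen d m n S)
  have hR := resistanceDist_eq_of_green (generalizedBlowUp (completeMinusStar k d) t p q) g (1 / n)
    (fun u x => by
      convert netFlow_blowUp_green (completeMinusStar k d) t p q m (starDegree d m n S) hm hpos
        hDpos (fun i => by convert starDegree_eq hd m n S hn hS i) (starGreen d m n S) (1 / n)
        (fun l i => by convert starGreen_eq hd m n S hS hpos hn0 hnS hnm l i)
        g hself hne u x)
  constructor
  · intro i a b
    rw [hR]
    simp only [hself]
    ring
  · intro i j a b hij
    rw [hR, hself, hself, hne _ _ _ _ hij, hne _ _ _ _ hij.symm]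
    ring

/-! ### Closed forms of the resistances -/

theorem partGreen_inr_self {t p q : ℕ} {D N : ℝ} (hD : 0 < D) (hN : 0 < N) (b : Fin q) :
    partGreen (t := t) (p := p) D N (Sum.inr b) (Sum.inr b) = (N - 1) / (N * D) := by
  simp only [partGreen, if_true]
  field_simp

/-- The diagonal entries are the terms c(w) of the claim. -/
theorem partGreen_inl_self {t p q : ℕ} {D N : ℝ} (hD : 0 < D) (hN : 0 < N) (a : Fin p × Fin t) :
    partGreen (q := q) D N (Sum.inl a) (Sum.inl a) =
      ((N - 1) * (D + 1) + 1 - t) / (N * D * (D + t)) := by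
  have hDt : 0 < D + t := by positivity
  simp only [partGreen, if_true]
  field_simp
  ring

/-- The resistance distances inside a part. -/
theorem resistanceDist_same_part {k t : ℕ} {p q : Fin k → ℕ} (H : SimpleGraph (Fin k)) (i : Fin k)
    {D N : ℝ} (hD : 0 < D) (hN : 0 < N)
    (hR : ∀ a b, resistanceDist (generalizedBlowUp H t p q) ⟨i, a⟩ ⟨i, b⟩ =
      partGreen D N a a + partGreen D N b b - partGreen D N a b - partGreen D N b a) :
    (∀ u ∈ Vq t p q i, ∀ v ∈ Vq t p q i, u ≠ v →
        resistanceDist (generalizedBlowUp H t p q) u v = 2 / D) ∧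
      (∀ u ∈ Vp t p q i, ∀ v ∈ Vq t p q i,
        resistanceDist (generalizedBlowUp H t p q) u v = (2 * D + t + 1) / (D * (D + t))) ∧
      (∀ u ∈ Vp t p q i, ∀ v ∈ Vp t p q i, u ≠ v → (generalizedBlowUp H t p q).Adj u v →
        resistanceDist (generalizedBlowUp H t p q) u v = 2 / (D + t)) ∧
      (∀ u ∈ Vp t p q i, ∀ v ∈ Vp t p q i, u ≠ v → ¬ (generalizedBlowUp H t p q).Adj u v →
        resistanceDist (generalizedBlowUp H t p q) u v = 2 * (D + 1) / (D * (D + t))) := by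
  have hDt : 0 < D + t := by positivity
  have hadj : ∀ a c a' c', (generalizedBlowUp H t p q).Adj ⟨i, Sum.inl (a, c)⟩
      ⟨i, Sum.inl (a', c')⟩ ↔ a = a' ∧ c ≠ c' := by
    intro a c a' c'
    rw [← partGraph_adj_inl (q := q i)]
    constructor
    · rintro (h | ⟨j, x, y, hx, hy, h⟩)
      · exact absurd h (H.loopless.irrefl _)
      · obtain ⟨rfl, hx⟩ := Sigma.mk.inj hx
        obtain rfl := eq_of_heq hx
        obtain rfl := eq_of_heq (Sigma.mk.inj hy).2
        exact h
    · exact fun h => Or.inr ⟨i, _, _, rfl, rfl, h⟩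
  refine ⟨?_, ?_, ?_, ?_⟩
  · rintro _ ⟨b, rfl⟩ _ ⟨b', rfl⟩ h
    have hb : b ≠ b' := fun e => h (by rw [e])
    rw [hR]
    simp [partGreen, hb, hb.symm]
    field_simp
    ring
  · rintro _ ⟨a, rfl⟩ _ ⟨b, rfl⟩
    rw [hR]
    simp [partGreen]
    field_simp
    ring
  · rintro _ ⟨⟨a, c⟩, rfl⟩ _ ⟨⟨a', c'⟩, rfl⟩ - h
    obtain ⟨rfl, hc⟩ := (hadj _ _ _ _).mp h
    rw [hR]
    simp [partGreen, hc, hc.symm]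
    field_simp
    ring
  · rintro _ ⟨⟨a, c⟩, rfl⟩ _ ⟨⟨a', c'⟩, rfl⟩ hne h
    have ha : a ≠ a' := by
      rintro rfl
      exact h ((hadj _ _ _ _).mpr ⟨rfl, fun e => hne (by rw [e])⟩)
    rw [hR]
    simp [partGreen, ha, ha.symm]
    field_simp
    ring

/-- The resistance distances between two parts. -/
theorem resistanceDist_different_parts {k t : ℕ} {p q : Fin k → ℕ} (G : SimpleGraph _)
    (i j : Fin k) {D N D' N' R : ℝ} (hD : 0 < D) (hN : 0 < N) (hD' : 0 < D') (hN' : 0 < N')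
    (hR : ∀ a b, resistanceDist (V := BlowUpVertex t p q) G ⟨i, a⟩ ⟨j, b⟩ =
      R + (partGreen D N a a + partGreen D' N' b b)) :
    (∀ u ∈ Vq t p q i, ∀ v ∈ Vq t p q j, resistanceDist G u v =
        R + ((N - 1) / (N * D) + (N' - 1) / (N' * D'))) ∧
      (∀ u ∈ Vq t p q i, ∀ v ∈ Vp t p q j, resistanceDist G u v =
        R + ((N - 1) / (N * D) +
          ((N' - 1) * (D' + 1) + 1 - t) / (N' * D' * (D' + t)))) ∧
      (∀ u ∈ Vp t p q i, ∀ v ∈ Vq t p q j, resistanceDist G u v =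
        R + (((N - 1) * (D + 1) + 1 - t) / (N * D * (D + t)) + (N' - 1) / (N' * D'))) ∧
      (∀ u ∈ Vp t p q i, ∀ v ∈ Vp t p q j, resistanceDist G u v =
        R + (((N - 1) * (D + 1) + 1 - t) / (N * D * (D + t)) +
          ((N' - 1) * (D' + 1) + 1 - t) / (N' * D' * (D' + t)))) := by
  refine ⟨?_, ?_, ?_, ?_⟩ <;> rintro _ ⟨a, rfl⟩ _ ⟨b, rfl⟩ <;> rw [hR]
  · rw [partGreen_inr_self hD hN, partGreen_inr_self hD' hN']
  · rw [partGreen_inr_self hD hN, partGreen_inl_self hD' hN']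
  · rw [partGreen_inl_self hD hN, partGreen_inr_self hD' hN']
  · rw [partGreen_inl_self hD hN, partGreen_inl_self hD' hN']

/-! ### The resistance distances of the blow-up -/

theorem corollaryc35 (k d t : ℕ) [NeZero k] (hd : 1 ≤ d) (hdk : d < k) (ht : 1 ≤ t)
    (p q : Fin k → ℕ)
    (G : SimpleGraph (BlowUpVertex t p q))
    (hG : G = generalizedBlowUp (completeMinusStar k d) t p q)
    -- `m i` is the size of the `i`-th part, `n` the order of `G`, and `S` the total size
    -- of the parts of the star
    (m : Fin k → ℝ) (hm : ∀ i, m i = Fintype.card (PartVertex t (p i) (q i)))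
    (hpos : ∀ i, 0 < m i)
    (n : ℝ) (hn : n = Fintype.card (BlowUpVertex t p q))
    (S : ℝ) (hS : S = ∑ s : Fin k with s.val < d, m s) :
    G.Connected ∧
    -- Both vertices in the part of the star centre.
    ((∀ u ∈ Vq t p q 0, ∀ v ∈ Vq t p q 0, u ≠ v →
        resistanceDist G u v = 2 / (n - S)) ∧
      (∀ u ∈ Vp t p q 0, ∀ v ∈ Vq t p q 0,
        resistanceDist G u v = (2 * (n - S) + t + 1) / ((n - S) * ((n - S) + t))) ∧
      (∀ u ∈ Vp t p q 0, ∀ v ∈ Vp t p q 0, u ≠ v → G.Adj u v →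
        resistanceDist G u v = 2 / ((n - S) + t)) ∧
      (∀ u ∈ Vp t p q 0, ∀ v ∈ Vp t p q 0, u ≠ v → ¬ G.Adj u v →
        resistanceDist G u v = 2 * ((n - S) + 1) / ((n - S) * ((n - S) + t)))) ∧
    -- Both vertices in the part of the same star leaf.
    (∀ i : Fin k, 1 ≤ i.val → i.val < d →
      (∀ u ∈ Vq t p q i, ∀ v ∈ Vq t p q i, u ≠ v →
        resistanceDist G u v = 2 / (n - m 0 - m i)) ∧
      (∀ u ∈ Vp t p q i, ∀ v ∈ Vq t p q i,
        resistanceDist G u v = (2 * (n - m 0 - m i) + t + 1) / ((n - m 0 - m i) * ((n - m 0 - m i) + t))) ∧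
      (∀ u ∈ Vp t p q i, ∀ v ∈ Vp t p q i, u ≠ v → G.Adj u v →
        resistanceDist G u v = 2 / ((n - m 0 - m i) + t)) ∧
      (∀ u ∈ Vp t p q i, ∀ v ∈ Vp t p q i, u ≠ v → ¬ G.Adj u v →
        resistanceDist G u v = 2 * ((n - m 0 - m i) + 1) / ((n - m 0 - m i) * ((n - m 0 - m i) + t)))) ∧
    -- Both vertices in the same part outside the star.
    (∀ i : Fin k, d ≤ i.val →
      (∀ u ∈ Vq t p q i, ∀ v ∈ Vq t p q i, u ≠ v →
        resistanceDist G u v = 2 / (n - m i)) ∧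
      (∀ u ∈ Vp t p q i, ∀ v ∈ Vq t p q i,
        resistanceDist G u v = (2 * (n - m i) + t + 1) / ((n - m i) * ((n - m i) + t))) ∧
      (∀ u ∈ Vp t p q i, ∀ v ∈ Vp t p q i, u ≠ v → G.Adj u v →
        resistanceDist G u v = 2 / ((n - m i) + t)) ∧
      (∀ u ∈ Vp t p q i, ∀ v ∈ Vp t p q i, u ≠ v → ¬ G.Adj u v →
        resistanceDist G u v = 2 * ((n - m i) + 1) / ((n - m i) * ((n - m i) + t)))) ∧
    -- Star centre and star leaf.
    (∀ i : Fin k, 1 ≤ i.val → i.val < d →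
      (∀ u ∈ Vq t p q 0, ∀ v ∈ Vq t p q i,
        resistanceDist G u v = (n * m i + m 0 * (n - S)) / (m 0 * m i * (n - m 0) * (n - S)) +
          ((m 0 - 1) / (m 0 * (n - S)) +
            (m i - 1) / (m i * (n - m 0 - m i)))) ∧
      (∀ u ∈ Vq t p q 0, ∀ v ∈ Vp t p q i,
        resistanceDist G u v = (n * m i + m 0 * (n - S)) / (m 0 * m i * (n - m 0) * (n - S)) +
          ((m 0 - 1) / (m 0 * (n - S)) +
            ((m i - 1) * ((n - m 0 - m i) + 1) + 1 - t) / (m i * (n - m 0 - m i) * ((n - m 0 - m i) + t)))) ∧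
      (∀ u ∈ Vp t p q 0, ∀ v ∈ Vq t p q i,
        resistanceDist G u v = (n * m i + m 0 * (n - S)) / (m 0 * m i * (n - m 0) * (n - S)) +
          (((m 0 - 1) * ((n - S) + 1) + 1 - t) / (m 0 * (n - S) * ((n - S) + t)) +
            (m i - 1) / (m i * (n - m 0 - m i)))) ∧
      (∀ u ∈ Vp t p q 0, ∀ v ∈ Vp t p q i,
        resistanceDist G u v = (n * m i + m 0 * (n - S)) / (m 0 * m i * (n - m 0) * (n - S)) +
          (((m 0 - 1) * ((n - S) + 1) + 1 - t) / (m 0 * (n - S) * ((n - S) + t)) +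
            ((m i - 1) * ((n - m 0 - m i) + 1) + 1 - t) / (m i * (n - m 0 - m i) * ((n - m 0 - m i) + t))))) ∧
    -- Star centre and part outside the star.
    (∀ i : Fin k, d ≤ i.val →
      (∀ u ∈ Vq t p q 0, ∀ v ∈ Vq t p q i,
        resistanceDist G u v = ((n - m 0) / (n * m 0 * (n - S)) + 1 / (n * m i)) +
          ((m 0 - 1) / (m 0 * (n - S)) +
            (m i - 1) / (m i * (n - m i)))) ∧
      (∀ u ∈ Vq t p q 0, ∀ v ∈ Vp t p q i,
        resistanceDist G u v = ((n - m 0) / (n * m 0 * (n - S)) + 1 / (n * m i)) +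
          ((m 0 - 1) / (m 0 * (n - S)) +
            ((m i - 1) * ((n - m i) + 1) + 1 - t) / (m i * (n - m i) * ((n - m i) + t)))) ∧
      (∀ u ∈ Vp t p q 0, ∀ v ∈ Vq t p q i,
        resistanceDist G u v = ((n - m 0) / (n * m 0 * (n - S)) + 1 / (n * m i)) +
          (((m 0 - 1) * ((n - S) + 1) + 1 - t) / (m 0 * (n - S) * ((n - S) + t)) +
            (m i - 1) / (m i * (n - m i)))) ∧
      (∀ u ∈ Vp t p q 0, ∀ v ∈ Vp t p q i,
        resistanceDist G u v = ((n - m 0) / (n * m 0 * (n - S)) + 1 / (n * m i)) +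
          (((m 0 - 1) * ((n - S) + 1) + 1 - t) / (m 0 * (n - S) * ((n - S) + t)) +
            ((m i - 1) * ((n - m i) + 1) + 1 - t) / (m i * (n - m i) * ((n - m i) + t))))) ∧
    -- Two different star leaves.
    (∀ i j : Fin k, i ≠ j → 1 ≤ i.val → i.val < d → 1 ≤ j.val → j.val < d →
      (∀ u ∈ Vq t p q i, ∀ v ∈ Vq t p q j,
        resistanceDist G u v = (m i + m j) / ((n - m 0) * m i * m j) +
          ((m i - 1) / (m i * (n - m 0 - m i)) +
            (m j - 1) / (m j * (n - m 0 - m j)))) ∧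
      (∀ u ∈ Vp t p q i, ∀ v ∈ Vq t p q j,
        resistanceDist G u v = (m i + m j) / ((n - m 0) * m i * m j) +
          (((m i - 1) * ((n - m 0 - m i) + 1) + 1 - t) / (m i * (n - m 0 - m i) * ((n - m 0 - m i) + t)) +
            (m j - 1) / (m j * (n - m 0 - m j)))) ∧
      (∀ u ∈ Vp t p q i, ∀ v ∈ Vp t p q j,
        resistanceDist G u v = (m i + m j) / ((n - m 0) * m i * m j) +
          (((m i - 1) * ((n - m 0 - m i) + 1) + 1 - t) / (m i * (n - m 0 - m i) * ((n - m 0 - m i) + t)) +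
            ((m j - 1) * ((n - m 0 - m j) + 1) + 1 - t) / (m j * (n - m 0 - m j) * ((n - m 0 - m j) + t))))) ∧
    -- Star leaf and part outside the star.
    (∀ i j : Fin k, 1 ≤ i.val → i.val < d → d ≤ j.val →
      (∀ u ∈ Vq t p q i, ∀ v ∈ Vq t p q j,
        resistanceDist G u v = ((m 0 * m i + n * (n - S)) / (n * m i * (n - m 0) * (n - S)) + 1 / (n * m j)) +
          ((m i - 1) / (m i * (n - m 0 - m i)) +
            (m j - 1) / (m j * (n - m j)))) ∧
      (∀ u ∈ Vq t p q i, ∀ v ∈ Vp t p q j,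
        resistanceDist G u v = ((m 0 * m i + n * (n - S)) / (n * m i * (n - m 0) * (n - S)) + 1 / (n * m j)) +
          ((m i - 1) / (m i * (n - m 0 - m i)) +
            ((m j - 1) * ((n - m j) + 1) + 1 - t) / (m j * (n - m j) * ((n - m j) + t)))) ∧
      (∀ u ∈ Vp t p q i, ∀ v ∈ Vq t p q j,
        resistanceDist G u v = ((m 0 * m i + n * (n - S)) / (n * m i * (n - m 0) * (n - S)) + 1 / (n * m j)) +
          (((m i - 1) * ((n - m 0 - m i) + 1) + 1 - t) / (m i * (n - m 0 - m i) * ((n - m 0 - m i) + t)) +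
            (m j - 1) / (m j * (n - m j)))) ∧
      (∀ u ∈ Vp t p q i, ∀ v ∈ Vp t p q j,
        resistanceDist G u v = ((m 0 * m i + n * (n - S)) / (n * m i * (n - m 0) * (n - S)) + 1 / (n * m j)) +
          (((m i - 1) * ((n - m 0 - m i) + 1) + 1 - t) / (m i * (n - m 0 - m i) * ((n - m 0 - m i) + t)) +
            ((m j - 1) * ((n - m j) + 1) + 1 - t) / (m j * (n - m j) * ((n - m j) + t))))) ∧
    -- Two different parts outside the star.
    (∀ i j : Fin k, i ≠ j → d ≤ i.val → d ≤ j.val →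
      (∀ u ∈ Vq t p q i, ∀ v ∈ Vq t p q j,
        resistanceDist G u v = (1 / (n * m i) + 1 / (n * m j)) +
          ((m i - 1) / (m i * (n - m i)) +
            (m j - 1) / (m j * (n - m j)))) ∧
      (∀ u ∈ Vp t p q i, ∀ v ∈ Vq t p q j,
        resistanceDist G u v = (1 / (n * m i) + 1 / (n * m j)) +
          (((m i - 1) * ((n - m i) + 1) + 1 - t) / (m i * (n - m i) * ((n - m i) + t)) +
            (m j - 1) / (m j * (n - m j)))) ∧
      (∀ u ∈ Vp t p q i, ∀ v ∈ Vp t p q j,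
        resistanceDist G u v = (1 / (n * m i) + 1 / (n * m j)) +
          (((m i - 1) * ((n - m i) + 1) + 1 - t) / (m i * (n - m i) * ((n - m i) + t)) +
            ((m j - 1) * ((n - m j) + 1) + 1 - t) / (m j * (n - m j) * ((n - m j) + t))))) := by
  subst hG
  have hne : ∀ i, Nonempty (PartVertex t (p i) (q i)) := fun i => by
    have h := hpos i
    rw [hm] at h
    exact Fintype.card_pos_iff.mp (by exact_mod_cast h)
  have hn' : n = ∑ i, m i := by
    rw [hn, Fintype.card_sigma, Nat.cast_sum]
    exact Finset.sum_congr rfl fun i _ => (hm i).symm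
  -- Part d lies outside the star and has positive size, so removing parts other than it leaves a
  -- positive total. This gives every positivity needed except that of n - m_i for i outside the
  -- star.
  have hlast : ∀ s : Finset (Fin k), ⟨d, hdk⟩ ∉ s → 0 < n - ∑ i ∈ s, m i := fun s hs => by
    rw [hn', sub_pos]
    exact Finset.sum_lt_sum_of_subset (Finset.subset_univ s) (Finset.mem_univ ⟨d, hdk⟩) hs
      (hpos _) fun i _ _ => (hpos i).le
  have hv0 : ((0 : Fin k) : ℕ) = 0 := rfl
  have hlast0 : (⟨d, hdk⟩ : Fin k) ≠ 0 := by simp [Fin.ext_iff]; omega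
  have hn0 : 0 < n := by simpa using hlast ∅ (by simp)
  have hnS : 0 < n - S := by simpa [hS] using hlast {s | s.val < d} (by simp)
  have hnm : 0 < n - m 0 := by simpa using hlast {0} (by simpa using hlast0)
  have hC : starDegree d m n S 0 = n - S := by simp [starDegree]
  have hz : ∀ i : Fin k, 1 ≤ i.val → i ≠ 0 := by
    rintro i hi rfl
    simp at hi
  have hL : ∀ i : Fin k, 1 ≤ i.val → i.val < d → starDegree d m n S i = n - m 0 - m i :=
    fun i h1 h2 => by simp [starDegree, hz i h1, h2]
  have hO : ∀ i : Fin k, d ≤ i.val → starDegree d m n S i = n - m i :=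
    fun i h => by simp [starDegree, hz i (hd.trans h), not_lt.mpr h]
  have hDC : 0 < n - S := hnS
  have hDL : ∀ i : Fin k, 1 ≤ i.val → i.val < d → 0 < n - m 0 - m i := fun i h1 h2 => by
    have h := hlast {0, i} (by
      have : (⟨d, hdk⟩ : Fin k) ≠ i := fun e => by simp [← e] at h2
      simp [hlast0, this, -Fin.mk_eq_zero])
    rw [Finset.sum_pair (hz i h1).symm] at h
    linarith
  -- Here i may be d itself; part 0 is the one that surely remains.
  have hDO : ∀ i : Fin k, d ≤ i.val → 0 < n - m i := fun i h => by
    rw [hn', sub_pos, ← Finset.sum_singleton m i]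
    exact Finset.sum_lt_sum_of_subset (Finset.subset_univ _) (Finset.mem_univ 0)
      (by simpa using (hz i (hd.trans h)).symm) (hpos _) fun i _ _ => (hpos i).le
  have hDpos : ∀ i, 0 < starDegree d m n S i := fun i => by
    rcases eq_or_ne i 0 with rfl | h0
    · rwa [hC]
    · have h1 : 1 ≤ i.val := Nat.one_le_iff_ne_zero.mpr fun h => h0 (Fin.ext (by simpa using h))
      rcases lt_or_ge i.val d with h | h
      · rw [hL i h1 h]
        exact hDL i h1 h
      · rw [hO i h]
        exact hDO i h
  obtain ⟨hsame, hdiff⟩ :=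
    resistanceDist_blowUp hd p q m hm hpos n S hn' hS hn0 hnS hnm hDpos
  have hpos0 := hpos 0
  have hnS' := hnS.ne'
  have hnm' := hnm.ne'
  refine ⟨completeMinusStar_blowUp_connected hd hdk p q hne, ?_, ?_, ?_, ?_, ?_, ?_, ?_, ?_⟩
  · exact resistanceDist_same_part _ 0 hDC (hpos 0) fun a b => by rw [hsame, hC]
  · intro i h1 h2
    exact resistanceDist_same_part _ i (hDL i h1 h2) (hpos i) fun a b => by rw [hsame, hL i h1 h2]
  · intro i h
    exact resistanceDist_same_part _ i (hDO i h) (hpos i) fun a b => by rw [hsame, hO i h]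
  · intro i h1 h2
    refine resistanceDist_different_parts _ 0 i hDC (hpos 0) (hDL i h1 h2) (hpos i) fun a b => ?_
    have hi := hpos i
    rw [hdiff _ _ _ _ (hz i h1).symm, hC, hL i h1 h2]
    -- The local terms agree on both sides; what remains is the identity between the entries of
    -- `starGreen` and R'.
    congr 1
    simp [starGreen, hz i h1, h2]
    field_simp
    ring
  · intro i h
    refine resistanceDist_different_parts _ 0 i hDC (hpos 0) (hDO i h) (hpos i) fun a b => ?_
    have h0 := hz i (hd.trans h)
    rw [hdiff _ _ _ _ h0.symm, hC, hO i h]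
    congr 1
    simp [starGreen, h0, h0.symm, not_lt.mpr h]
  · intro i j hij h1 h2 h3 h4
    -- The roles of i and j are symmetric, so one of the two mixed cases is enough.
    obtain ⟨hqq, -, hpq, hpp⟩ := resistanceDist_different_parts _ i j (hDL i h1 h2) (hpos i)
      (hDL j h3 h4) (hpos j) (R := (m i + m j) / ((n - m 0) * m i * m j)) fun a b => by
        have hi := hpos i
        have hj := hpos j
        rw [hdiff _ _ _ _ hij, hL i h1 h2, hL j h3 h4]
        congr 1
        simp [starGreen, hz i h1, hz j h3, h2, h4, hij, hij.symm]
        field_simp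
        ring
    exact ⟨hqq, hpq, hpp⟩
  · intro i j h1 h2 h
    refine resistanceDist_different_parts _ i j (hDL i h1 h2) (hpos i) (hDO j h) (hpos j)
      fun a b => ?_
    have hi := hpos i
    have hj := hpos j
    have hij : i ≠ j := by
      rintro rfl
      omega
    rw [hdiff _ _ _ _ hij, hL i h1 h2, hO j h]
    congr 1
    simp [starGreen, hz i h1, hz j (hd.trans h), h2, not_lt.mpr h, hij]
    field_simp
    ring
  · intro i j hij h h'
    obtain ⟨hqq, -, hpq, hpp⟩ := resistanceDist_different_parts _ i j (hDO i h) (hpos i)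
      (hDO j h') (hpos j) (R := 1 / (n * m i) + 1 / (n * m j)) fun a b => by
        rw [hdiff _ _ _ _ hij, hO i h, hO j h']
        congr 1
        simp [starGreen, hz i (hd.trans h), hz j (hd.trans h'), not_lt.mpr h, not_lt.mpr h', hij,
          hij.symm]
    exact ⟨hqq, hpq, hpp⟩
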